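/- Let $k$ be a positive even integer. For positive integers $m$ put \[ S_k(m) = 1^k + 2^k + \cdots + (m-1)^k, \qquad g_k(m) = \frac{\gcd(S_k(m), S_k(m+1))}{m}, \] and write the $k$-th Bernoulli number (defined by $\frac{z}{e^z-1} = \sum_{n\ge 0} B_n \frac{z^n}{n!}$) as $B_k = N_k/D_k$ in lowest terms with $D_k > 0$. Then: 1. The minimum and the maximum of $g_k(m)$ over all integers $m \ge 2$ exist, and \[ \min_{m \ge 2} g_k(m) = \frac{1}{D_k}, \qquad \max_{m \ge 2} g_k(m) \ge |N_k|. \] 2. For every positive integer $m$, $g_k(m) = 1$ if and only if $\gcd(D_k N_k, m) = 1$. 3. $g_k(D_k) = \dfrac{1}{D_k}$ and $g_k(|N_k|) = |N_k|$. 4. If $N_k$ is squarefree, then $\max_{m \ge 2} g_k(m) = |N_k|$. -/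

import Mathlib

/-- The power sum `S_k(m) = 1^k + 2^k + ... + (m-1)^k`. -/
def powerSumS (k m : ℕ) : ℕ := ∑ j ∈ Finset.Ico 1 m, j ^ k

/-- `g_k(m) = gcd(S_k(m), S_k(m+1)) / m`, a rational number (used for `m ≥ 1`). -/
def gcdRatio (k m : ℕ) : ℚ := (Nat.gcd (powerSumS k m) (powerSumS k (m + 1)) : ℚ) / (m : ℚ)

/-- The numerator `N_k` of the Bernoulli number `B_k` in lowest terms. -/
def bernoulliNum (k : ℕ) : ℤ := (bernoulli k).num

/-- The denominator `D_k > 0` of the Bernoulli number `B_k` in lowest terms. -/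
def bernoulliDen (k : ℕ) : ℕ := (bernoulli k).den

/-! Everything is decided one prime at a time. Since `S_k(m+1) = S_k(m) + m^k`, the gcd is that of
`S_k(m)` and `m^k`, so the `p`-adic norm of `g_k(m)` is the larger of `|S_k(m)/m|` and `|m|^(k-1)`.
It is 1 when `p ∤ m`. When `p ∣ m`, Faulhaber's formula writes `S_k(m)/m` as `B_k` plus an error,
and the ultrametric inequality transfers the norm of `B_k` as soon as the error is strictly smaller.

By von Staudt–Clausen, `|B_k| = p` exactly when `p ∣ D_k`, which includes 2 and 3. There an error of
norm at most 1 suffices. Other primes satisfy `p ≥ 5`, and the error is at most `|m|`, which settles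
`p ∤ N_k`.

If `p ∣ N_k`, evaluating `g_k` at `|N_k|` requires an error below `|N_k|` even when `|m| = |N_k|`,
hence the sharper bound `|m|/p` of `padicNorm_powerSumS_div_sub_le_div`. Its delicate term is
`B_{k-2} * C(k,2) * m^2/3` when `p - 1 ∣ k - 2`: then `B_{k-2}` has `p` in its denominator, and `p ∣
k` must compensate (`dvd_of_dvd_bernoulliNum`). That divisibility comes from power sums modulo
`p^2`.

Comparing norms at all primes gives the equalities and inequalities between positive rationals
(`le_of_forall_padicNorm_le`). The maximum exists because `g_k` takes finitely many values. -/

open Finset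

/-! ### Bernoulli numbers at a prime: von Staudt–Clausen, numerator and denominator. -/

section BernoulliNorm

variable {p : ℕ} [hp : Fact p.Prime]

lemma padicNorm_one_div_prime : padicNorm p (1 / (p : ℚ)) = p := by
  rw [padicNorm.div, padicNorm.padicNorm_p_of_prime]; simp

lemma padicNorm_sum_one_div_prime_le_one (s : Finset ℕ) (hs : ∀ q ∈ s, q.Prime) (h : p ∉ s) :
    padicNorm p (∑ q ∈ s, (1 : ℚ) / q) ≤ 1 := by
  refine padicNorm.sum_le' (fun q hq ↦ ?_) zero_le_one
  have : Fact q.Prime := ⟨hs q hq⟩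
  have hpq : p ≠ q := fun e ↦ h (e ▸ hq)
  rw [padicNorm.div, padicNorm.padicNorm_of_prime_of_ne hpq]
  simp

/-- The `p`-adic form of the von Staudt–Clausen theorem. -/
lemma padicNorm_bernoulli_even {k : ℕ} (hk : Even k) (hk0 : 0 < k) :
    ((p - 1 ∣ k) → padicNorm p (bernoulli k) = p) ∧
      (¬ (p - 1 ∣ k) → padicNorm p (bernoulli k) ≤ 1) := by
  obtain ⟨n, rfl⟩ := hk.two_dvd
  obtain ⟨z, hz⟩ := Bernoulli.vonStaudt_clausen n
  set s := {q ∈ range (2 * n + 2) | q.Prime ∧ (q - 1) ∣ 2 * n} with hs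
  have hsp : ∀ q ∈ s, q.Prime := fun q hq ↦ (mem_filter.1 hq).2.1
  have hp1 : (1 : ℚ) < p := by exact_mod_cast hp.out.one_lt
  constructor
  · intro hd
    have hmem : p ∈ s := by
      have := Nat.le_of_dvd hk0 hd
      simp only [hs, mem_filter, mem_range]
      exact ⟨by omega, hp.out, hd⟩
    have hB : bernoulli (2 * n) = (z - ∑ q ∈ s.erase p, (1 : ℚ) / q) + -(1 / p) := by
      rw [← add_sum_erase s _ hmem] at hz
      linarith
    have h1 : padicNorm p (z - ∑ q ∈ s.erase p, (1 : ℚ) / q) ≤ 1 :=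
      padicNorm.sub.trans (max_le (padicNorm.of_int z)
        (padicNorm_sum_one_div_prime_le_one _ (fun q hq ↦ hsp q (mem_of_mem_erase hq)) (by simp)))
    have h2 : padicNorm p (-(1 / (p : ℚ))) = p := by
      rw [padicNorm.neg, padicNorm_one_div_prime]
    rw [hB, padicNorm.add_eq_max_of_ne (by rw [h2]; exact (h1.trans_lt hp1).ne), h2]
    exact max_eq_right (h1.trans hp1.le)
  · intro hd
    have hmem : p ∉ s := fun h ↦ hd (mem_filter.1 h).2.2
    have hB : bernoulli (2 * n) = z - ∑ q ∈ s, (1 : ℚ) / q := by linarith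
    rw [hB]
    exact padicNorm.sub.trans (max_le (padicNorm.of_int z)
      (padicNorm_sum_one_div_prime_le_one _ hsp hmem))

lemma padicNorm_bernoulli_even_le {k : ℕ} (hk : Even k) :
    padicNorm p (bernoulli k) ≤ p := by
  have hp1 : (1 : ℚ) ≤ p := by exact_mod_cast hp.out.one_le
  rcases Nat.eq_zero_or_pos k with rfl | h0
  · simpa using hp1
  · by_cases h : p - 1 ∣ k
    · exact ((padicNorm_bernoulli_even hk h0).1 h).le
    · exact ((padicNorm_bernoulli_even hk h0).2 h).trans hp1

lemma dvd_bernoulliDen_iff_one_lt {k : ℕ} :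
    p ∣ bernoulliDen k ↔ 1 < padicNorm p (bernoulli k) := by
  unfold bernoulliDen
  have hq := padicNorm.div (p := p) (bernoulli k).num (bernoulli k).den
  rw [Rat.num_div_den] at hq
  have hd0 : (0 : ℚ) < padicNorm p (bernoulli k).den :=
    lt_of_le_of_ne (padicNorm.nonneg _)
      (padicNorm.nonzero (by exact_mod_cast (bernoulli k).den_ne_zero)).symm
  constructor
  · intro h
    have hn : padicNorm p (bernoulli k).num = 1 := by
      rw [padicNorm.int_eq_one_iff]
      intro h'
      have := (bernoulli k).reduced
      exact hp.out.one_lt.ne' (Nat.dvd_one.1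
        (this ▸ Nat.dvd_gcd (Int.natCast_dvd.1 h') h))
    rw [hq, hn, one_lt_div hd0]
    exact padicNorm.nat_lt_one_iff _ |>.2 h
  · intro h
    by_contra h'
    rw [hq, (padicNorm.nat_eq_one_iff _).2 h', div_one] at h
    exact absurd (padicNorm.of_int _) (not_le.2 h)

lemma dvd_bernoulliDen_iff {k : ℕ} (hk : Even k) (hk0 : 0 < k) :
    p ∣ bernoulliDen k ↔ p - 1 ∣ k := by
  rw [dvd_bernoulliDen_iff_one_lt]
  have hp1 : (1 : ℚ) < p := by exact_mod_cast hp.out.one_lt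
  constructor
  · intro h
    by_contra h'
    exact absurd ((padicNorm_bernoulli_even hk hk0).2 h') (not_le.2 h)
  · intro h
    rwa [(padicNorm_bernoulli_even hk hk0).1 h]

lemma padicNorm_bernoulliNum_of_not_dvd {k : ℕ} (h : ¬ p ∣ bernoulliDen k) :
    padicNorm p (bernoulliNum k) = padicNorm p (bernoulli k) := by
  have h1 : padicNorm p ((bernoulli k).den) = 1 := (padicNorm.nat_eq_one_iff _).2 h
  conv_rhs => rw [← Rat.num_div_den (bernoulli k), padicNorm.div, h1, div_one]
  rfl

lemma padicNorm_bernoulliNum_of_dvd {k : ℕ} (h : p ∣ bernoulliDen k) :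
    padicNorm p (bernoulliNum k) = 1 := by
  rw [padicNorm.int_eq_one_iff]
  intro h'
  exact hp.out.one_lt.ne' (Nat.dvd_one.1
    ((bernoulli k).reduced ▸ Nat.dvd_gcd (Int.natCast_dvd.1 h') h))

lemma padicNorm_bernoulliDen_of_dvd {k : ℕ} (hk : Even k) (hk0 : 0 < k)
    (h : p ∣ bernoulliDen k) : padicNorm p (bernoulliDen k) = 1 / p := by
  have h1 := (padicNorm_bernoulli_even hk hk0).1 ((dvd_bernoulliDen_iff hk hk0).1 h)
  have hp0 : (p : ℚ) ≠ 0 := by exact_mod_cast hp.out.ne_zero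
  have hd0 : padicNorm p (bernoulliDen k) ≠ 0 :=
    padicNorm.nonzero (by exact_mod_cast (bernoulli k).den_ne_zero)
  rw [← Rat.num_div_den (bernoulli k), padicNorm.div] at h1
  change padicNorm p (bernoulliNum k) / padicNorm p (bernoulliDen k) = p at h1
  rw [padicNorm_bernoulliNum_of_dvd h] at h1
  rw [← h1]; simp

/-- For `p = 2, 3` the number `p - 1` is 1 or 2 and divides the even `k`, so both primes divide
`D_k`. -/
lemma five_le_of_not_dvd_bernoulliDen {k : ℕ} (hk : Even k) (hk0 : 0 < k)
    (h : ¬ p ∣ bernoulliDen k) : 5 ≤ p := by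
  rw [dvd_bernoulliDen_iff hk hk0] at h
  by_contra hlt
  have h2 := hp.out.two_le
  have hq := hp.out
  interval_cases p
  · simp at h
  · exact h hk.two_dvd
  · exact absurd hq (by norm_num)

end BernoulliNorm

/-! ### Faulhaber's formula. -/

section PowerSum

lemma cast_powerSumS_eq_sum_range {k : ℕ} (hk : 0 < k) (m : ℕ) :
    (powerSumS k m : ℚ) = ∑ j ∈ range m, (j : ℚ) ^ k := by
  rw [powerSumS, range_eq_Ico]
  push_cast
  rcases Nat.eq_zero_or_pos m with rfl | hm
  · simp
  · rw [Finset.sum_eq_sum_Ico_succ_bot hm]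
    simp [hk.ne']

lemma powerSumS_succ (k : ℕ) {m : ℕ} (hm : 0 < m) :
    powerSumS k (m + 1) = powerSumS k m + m ^ k :=
  Finset.sum_Ico_succ_top hm _

/-- Faulhaber's formula divided by `m`, with the leading term `B_k` isolated. -/
lemma powerSumS_div_sub_bernoulli {k : ℕ} (hk : 0 < k) {m : ℕ} (hm : 0 < m) :
    (powerSumS k m : ℚ) / m - bernoulli k =
      ∑ i ∈ range k, bernoulli i * (k.choose i) * ((m : ℚ) ^ (k - i) / ((k - i : ℕ) + 1)) := by
  have hm0 : (m : ℚ) ≠ 0 := by exact_mod_cast hm.ne'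
  rw [cast_powerSumS_eq_sum_range hk, sum_range_pow, sum_range_succ, add_div]
  have hlast : bernoulli k * ((k + 1).choose k) * (m : ℚ) ^ (k + 1 - k) / (k + 1) / m =
      bernoulli k := by
    rw [Nat.choose_succ_self_right, Nat.add_sub_cancel_left]
    push_cast
    field_simp
  rw [hlast, add_sub_cancel_right, sum_div]
  refine sum_congr rfl fun i hi ↦ ?_
  have hik := mem_range.1 hi
  have hc : (k.choose i : ℚ) * (k + 1) = (k + 1).choose i * ((k - i : ℕ) + 1) := by
    have := Nat.choose_mul_succ_eq k i
    rw [show k + 1 - i = (k - i) + 1 by omega] at this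
    exact_mod_cast this
  rw [show k + 1 - i = (k - i) + 1 by omega, pow_succ]
  have h1 : ((k - i : ℕ) : ℚ) + 1 ≠ 0 := by positivity
  have h2 : (k : ℚ) + 1 ≠ 0 := by positivity
  field_simp
  linear_combination (-bernoulli i) * hc

end PowerSum

/-! ### Norms of the factors `m^j / (j+1)`. -/

section TermBounds

variable {p : ℕ} [hp : Fact p.Prime]

lemma exists_pow_dvd_padicNorm_eq {p n : ℕ} (hn : n ≠ 0) :
    ∃ v, p ^ v ∣ n ∧ padicNorm p n = ((p : ℚ) ^ v)⁻¹ := by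
  refine ⟨padicValNat p n, pow_padicValNat_dvd, ?_⟩
  rw [padicNorm.eq_zpow_of_nonzero (by exact_mod_cast hn), padicValRat.of_nat, zpow_neg,
    zpow_natCast]

lemma padicNorm_le_one_div_of_dvd {m : ℕ} (h : p ∣ m) : padicNorm p m ≤ 1 / p := by
  have := (padicNorm.dvd_iff_norm_le (p := p) (n := 1) (z := m)).1 (by
    rw [pow_one]; exact_mod_cast h)
  simpa using this

/-- One factor `m` is kept as `|m|`. The other `j - 1` each contribute at most `1/p`: `v` of them
absorb the denominator `j + 1` and `d` remain as gain. -/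
lemma padicNorm_pow_div_succ_le {m : ℚ} {j d : ℕ} (hm : padicNorm p m ≤ 1 / p)
    (hj : 0 < j) (h : ∀ v, p ^ v ∣ j + 1 → v + d + 1 ≤ j) :
    padicNorm p (m ^ j / (j + 1)) ≤ padicNorm p m * (1 / p) ^ d := by
  obtain ⟨v, hv, hn⟩ := exists_pow_dvd_padicNorm_eq (p := p) (n := j + 1) (by omega)
  have hp0 : (0 : ℚ) < p := by exact_mod_cast hp.out.pos
  have hp1 : (1 : ℚ) / p ≤ 1 := by
    rw [div_le_one hp0]; exact_mod_cast hp.out.one_le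
  have hρ := padicNorm.nonneg (p := p) m
  have hv' := h v hv
  push_cast at hn
  rw [padicNorm.div, hn, div_inv_eq_mul]
  obtain ⟨i, rfl⟩ : ∃ i, j = i + 1 := ⟨j - 1, by omega⟩
  rw [IsAbsoluteValue.abv_pow (padicNorm p), pow_succ', mul_assoc]
  refine mul_le_mul_of_nonneg_left ?_ hρ
  calc padicNorm p m ^ i * (p : ℚ) ^ v ≤ (1 / p) ^ i * (p : ℚ) ^ v := by gcongr
    _ ≤ (1 / p) ^ (v + d) * (p : ℚ) ^ v := by
        refine mul_le_mul_of_nonneg_right ?_ (by positivity)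
        exact pow_le_pow_of_le_one (by positivity) hp1 (by omega)
    _ = (1 / p) ^ d := by
        rw [pow_add, mul_right_comm, ← mul_pow, one_div_mul_cancel hp0.ne', one_pow, one_mul]

end TermBounds

/-! ### Power sums modulo `p^2` with exponent congruent to 2 modulo `p - 1`. -/

section TwoModPredPrime

variable {p : ℕ} [hp : Fact p.Prime]

lemma sum_zmod_val_eq_sum_range {M : Type*} [AddCommMonoid M] (f : ℕ → M) :
    ∑ x : ZMod p, f x.val = ∑ j ∈ range p, f j := by
  refine Finset.sum_nbij' ZMod.val (fun j ↦ (j : ZMod p)) ?_ ?_ ?_ ?_ ?_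
  · intro x _; exact mem_range.2 x.val_lt
  · intro j _; exact mem_univ _
  · intro x _; simp
  · intro j hj; exact ZMod.val_cast_of_lt (mem_range.1 hj)
  · intro x _; rfl

/-- For `p ≥ 5`, the sum of `j ^ (2 * p)` over residues modulo `p` vanishes modulo `p ^ 2`. -/
lemma sq_dvd_sum_pow_two_mul_prime (h5 : 5 ≤ p) :
    (p : ℤ) ^ 2 ∣ ∑ j ∈ range p, (j : ℤ) ^ (2 * p) := by
  set T : ℤ := ∑ j ∈ range p, (j : ℤ) ^ (2 * p) with hT
  have hpp := Nat.prime_iff_prime_int.1 hp.out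
  have hcong : ∀ a b : ℤ, (p : ℤ) ∣ a - b → (p : ℤ) ^ 2 ∣ a ^ (2 * p) - b ^ (2 * p) := by
    intro a b h
    have h1 : (p : ℤ) ^ 2 ∣ a ^ p - b ^ p := by
      simpa using dvd_sub_pow_of_dvd_sub (R := ℤ) (p := p) h 1
    rw [mul_comm 2 p, pow_mul, pow_mul]
    exact h1.trans (sub_dvd_pow_sub_pow _ _ 2)
  have h2 : (2 : ZMod p) ≠ 0 := by
    intro h
    have : ((2 : ℕ) : ZMod p) = 0 := by exact_mod_cast h
    have := Nat.le_of_dvd two_pos ((ZMod.natCast_eq_zero_iff _ _).1 this)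
    omega
  have hT1 : T = ∑ x : ZMod p, (x.val : ℤ) ^ (2 * p) :=
    (sum_zmod_val_eq_sum_range fun j ↦ (j : ℤ) ^ (2 * p)).symm
  -- Multiplication by 2 permutes the residues. As `j^(2p)` modulo `p^2` depends only on `j` modulo
  -- `p`, this yields `2^(2p) * T ≡ T`.
  have hT2 : T = ∑ x : ZMod p, ((2 * x).val : ℤ) ^ (2 * p) := by
    rw [hT1]
    exact (Equiv.sum_comp (Equiv.mulLeft₀ (2 : ZMod p) h2)
      (fun x : ZMod p ↦ (x.val : ℤ) ^ (2 * p))).symm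
  have hdvd : (p : ℤ) ^ 2 ∣ (2 ^ (2 * p) - 1) * T := by
    have : (2 ^ (2 * p) - 1) * T =
        ∑ x : ZMod p, ((2 * (x.val : ℤ)) ^ (2 * p) - ((2 * x).val : ℤ) ^ (2 * p)) := by
      rw [sum_sub_distrib, ← hT2]
      simp_rw [mul_pow]
      rw [← mul_sum, ← hT1]; ring
    rw [this]
    refine dvd_sum fun x _ ↦ hcong _ _ ?_
    rw [← ZMod.intCast_zmod_eq_zero_iff_dvd]
    push_cast
    simp
  have hcop : IsCoprime ((p : ℤ) ^ 2) (2 ^ (2 * p) - 1) := by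
    refine IsCoprime.pow_left ((Prime.coprime_iff_not_dvd hpp).2 fun h ↦ ?_)
    rw [← ZMod.intCast_zmod_eq_zero_iff_dvd] at h
    push_cast at h
    rw [mul_comm, pow_mul, ZMod.pow_card] at h
    -- By Fermat `2^(2p) - 1 ≡ 4 - 1 = 3` modulo `p`, a unit for `p ≥ 5`.
    have h3 : ((3 : ℕ) : ZMod p) = 0 := by
      push_cast; linear_combination h
    have := Nat.le_of_dvd three_pos ((ZMod.natCast_eq_zero_iff _ _).1 h3)
    omega
  exact hcop.dvd_of_dvd_mul_left hdvd

lemma sq_dvd_one_add_mul_pow_sub (a q : ℤ) (t : ℕ) :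
    a ^ 2 ∣ (1 + a * q) ^ t - (1 + t * (a * q)) := by
  induction t with
  | zero => simp
  | succ n ih =>
    obtain ⟨c, hc⟩ := ih
    refine ⟨c * (1 + a * q) + n * q ^ 2, ?_⟩
    push_cast
    rw [pow_succ]
    linear_combination (1 + a * q) * hc

lemma six_mul_sum_range_sq (n : ℕ) :
    6 * ∑ j ∈ range n, (j : ℤ) ^ 2 = n * (n - 1) * (2 * n - 1) := by
  induction n with
  | zero => simp
  | succ n ih => rw [sum_range_succ, mul_add, ih]; push_cast; ring

/-- If `k = 2 + (p - 1) t` and `p ^ 2` divides the `k`-th power sum up to `p`, then `p ∣ k`. -/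
lemma dvd_of_sq_dvd_sum_pow (h5 : 5 ≤ p) (t : ℕ)
    (h : (p : ℤ) ^ 2 ∣ ∑ j ∈ range p, (j : ℤ) ^ (2 + (p - 1) * t)) :
    p ∣ 2 + (p - 1) * t := by
  have hpp := Nat.prime_iff_prime_int.1 hp.out
  -- With `j^(p-1) = 1 + p q`, the exponents `2p = 2 + 2(p-1)` and `2 + (p-1)t` give `j^2 (1 + 2pq)`
  -- and `j^2 (1 + tpq)` modulo `p^2`. The weights `t` and `-2` cancel the terms in `q`.
  have hterm : ∀ j ∈ range p, (p : ℤ) ^ 2 ∣ (t : ℤ) * (j : ℤ) ^ (2 * p) -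
      2 * (j : ℤ) ^ (2 + (p - 1) * t) - (t - 2) * (j : ℤ) ^ 2 := by
    intro j hj
    rcases Nat.eq_zero_or_pos j with rfl | hj0
    · simp [show p ≠ 0 by omega]
    have hnd : ¬ p ∣ j := fun hd ↦ by
      have := Nat.le_of_dvd hj0 hd
      have := mem_range.1 hj
      omega
    have hf : (p : ℤ) ∣ (j : ℤ) ^ (p - 1) - 1 := by
      rw [← ZMod.intCast_zmod_eq_zero_iff_dvd]
      push_cast
      rw [ZMod.pow_card_sub_one_eq_one, sub_self]
      rwa [Ne, ZMod.natCast_eq_zero_iff]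
    obtain ⟨q, hq⟩ := hf
    have hj1 : (j : ℤ) ^ (p - 1) = 1 + p * q := by linarith
    have e1 : (j : ℤ) ^ (2 + (p - 1) * t) = (j : ℤ) ^ 2 * (1 + p * q) ^ t := by
      rw [pow_add, pow_mul, hj1]
    have e2 : (j : ℤ) ^ (2 * p) = (j : ℤ) ^ 2 * (1 + p * q) ^ 2 := by
      rw [← hj1, ← pow_mul, ← pow_add]
      congr 1; omega
    obtain ⟨c, hc⟩ := sq_dvd_one_add_mul_pow_sub (p : ℤ) q t
    rw [e1, e2]
    refine ⟨(j : ℤ) ^ 2 * (t * q ^ 2 - 2 * c), ?_⟩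
    linear_combination (-2 * (j : ℤ) ^ 2) * hc
  have hsum := dvd_sum hterm
  rw [sum_sub_distrib, sum_sub_distrib, ← mul_sum, ← mul_sum, ← mul_sum] at hsum
  have h3 := (dvd_sub ((sq_dvd_sum_pow_two_mul_prime h5).mul_left (t : ℤ)) (h.mul_left 2))
  have h4 := (dvd_sub h3 hsum).mul_left 6
  rw [sub_sub_cancel, mul_left_comm, six_mul_sum_range_sq] at h4
  obtain ⟨c, hc⟩ := h4
  have hp0 : (p : ℤ) ≠ 0 := hpp.ne_zero
  -- Only `(t - 2) ∑ j^2` survives, and the sum of squares has a single factor `p`. Hence `p ∣ t -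
  -- 2`, and `2 + (p-1)t ≡ 2 - t ≡ 0` modulo `p`.
  have h5' : ((t : ℤ) - 2) * ((p - 1) * (2 * p - 1)) = p * c := by
    apply mul_left_cancel₀ hp0
    linear_combination hc
  rw [← Int.natCast_dvd_natCast]
  refine ⟨(t - 2) * (2 * p - 3) - c + t, ?_⟩
  push_cast [Nat.cast_sub hp.out.one_le]
  linear_combination -h5'

end TwoModPredPrime

/-! ### The error `S_k(m)/m - B_k` at primes dividing `m`. -/

section Expansion

variable {p : ℕ} [hp : Fact p.Prime]

lemma padicNorm_bernoulli_odd_term {k i : ℕ} (hik : i < k) (hi : Odd i) (m : ℚ) :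
    bernoulli i * (k.choose i) * (m ^ (k - i) / ((k - i : ℕ) + 1)) = 0 ∨
      (i = 1 ∧ bernoulli i * (k.choose i) * (m ^ (k - i) / ((k - i : ℕ) + 1)) =
        -(m ^ (k - 1) / 2)) := by
  by_cases h : i = 1
  · subst h
    right
    refine ⟨rfl, ?_⟩
    have hk0 : (k : ℚ) ≠ 0 := by exact_mod_cast (by omega : k ≠ 0)
    rw [bernoulli_one, Nat.choose_one_right, Nat.cast_sub (by omega)]
    push_cast
    rw [sub_add_cancel]
    field_simp
  · left
    have : 1 < i := by obtain ⟨r, rfl⟩ := hi; omega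
    rw [bernoulli_eq_zero_of_odd hi this]; ring

lemma lt_of_pow_dvd_succ {p b j d v : ℕ} (hb : b ≤ p) (h : j + 1 < b ^ d) (hb1 : 1 < b)
    (hv : p ^ v ∣ j + 1) : v < d := by
  have h1 : b ^ v ≤ j + 1 :=
    (Nat.pow_le_pow_left hb v).trans (Nat.le_of_dvd (Nat.succ_pos _) hv)
  exact (Nat.pow_lt_pow_iff_right hb1).1 (h1.trans_lt h)

lemma add_one_lt_two_pow {j : ℕ} (hj : 2 ≤ j) : j + 1 < 2 ^ j := by
  induction j, hj using Nat.le_induction with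
  | base => norm_num
  | succ n hn ih => rw [pow_succ]; omega

/-- For `p ≥ 5` this bounds the `p`-adic valuation of `j + 1` by `j - 3`, which permits a gain of `d
= 2` in `padicNorm_pow_div_succ_le`. -/
lemma add_one_lt_five_pow {j : ℕ} (hj : 4 ≤ j) : j + 1 < 5 ^ (j - 2) := by
  induction j, hj using Nat.le_induction with
  | base => norm_num
  | succ n hn ih =>
    rw [show n + 1 - 2 = (n - 2) + 1 by omega, pow_succ]; omega

lemma padicNorm_two_of_five_le (h5 : 5 ≤ p) : padicNorm p 2 = 1 := by
  have := (padicNorm.nat_eq_one_iff (p := p) 2).2 fun h ↦ by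
    have := Nat.le_of_dvd two_pos h
    omega
  exact_mod_cast this

lemma inv_padicNorm_two_le : (padicNorm p 2)⁻¹ ≤ p := by
  obtain ⟨v, hv, hn⟩ := exists_pow_dvd_padicNorm_eq (p := p) (n := 2) (by norm_num)
  have := lt_of_pow_dvd_succ (j := 1) (d := 2) hp.out.two_le (by norm_num) one_lt_two hv
  push_cast at hn
  rw [hn, inv_inv]
  exact (pow_le_pow_right₀ (by exact_mod_cast hp.out.one_le) (by omega : v ≤ 1)).trans_eq (pow_one _)

variable {m : ℕ}

/-- Bound for the terms of even index in the expansion of `S_k(m) / m - B_k`. -/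
lemma padicNorm_bernoulli_even_term_le {i k d : ℕ} (hi : Even i) (hik : i < k) (hm : p ∣ m)
    (h : ∀ v, p ^ v ∣ (k - i) + 1 → v + d + 1 ≤ k - i) :
    padicNorm p (bernoulli i * (k.choose i) * ((m : ℚ) ^ (k - i) / ((k - i : ℕ) + 1))) ≤
      p * (padicNorm p m * (1 / p) ^ d) := by
  rw [padicNorm.mul, padicNorm.mul]
  refine mul_le_mul ?_ (padicNorm_pow_div_succ_le (padicNorm_le_one_div_of_dvd hm) (by omega) h)
    (padicNorm.nonneg _) (Nat.cast_nonneg _)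
  calc _ ≤ (p : ℚ) * 1 := mul_le_mul (padicNorm_bernoulli_even_le hi) (padicNorm.of_nat _)
        (padicNorm.nonneg _) (Nat.cast_nonneg _)
    _ = p := mul_one _

lemma padicNorm_powerSumS_div_sub_le_one {k : ℕ} (hk : Even k) (hk0 : 0 < k) (hm0 : 0 < m)
    (hm : p ∣ m) : padicNorm p ((powerSumS k m : ℚ) / m - bernoulli k) ≤ 1 := by
  have hp0 : (0 : ℚ) < p := by exact_mod_cast hp.out.pos
  have hρ := padicNorm_le_one_div_of_dvd hm
  have hρ' : (p : ℚ) * padicNorm p m ≤ 1 := by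
    calc (p : ℚ) * padicNorm p m ≤ p * (1 / p) := by gcongr
      _ = 1 := mul_one_div_cancel hp0.ne'
  rw [powerSumS_div_sub_bernoulli hk0 hm0]
  refine padicNorm.sum_le' (fun i hi ↦ ?_) zero_le_one
  have hik := mem_range.1 hi
  rcases Nat.even_or_odd i with he | ho
  · have hj : 2 ≤ k - i := by
      obtain ⟨a, rfl⟩ := he; obtain ⟨b, rfl⟩ := hk; omega
    refine (padicNorm_bernoulli_even_term_le (d := 0) he hik hm fun v hv ↦ ?_).trans (by simpa)
    have := lt_of_pow_dvd_succ hp.out.two_le (add_one_lt_two_pow hj) one_lt_two hv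
    omega
  · rcases padicNorm_bernoulli_odd_term hik ho m with h0 | ⟨rfl, h0⟩ <;> rw [h0]
    · simp
    rw [padicNorm.neg, padicNorm.div, IsAbsoluteValue.abv_pow (padicNorm p), div_eq_mul_inv]
    refine (mul_le_mul (pow_le_of_le_one (padicNorm.nonneg _) (padicNorm.of_nat m) (by omega))
      inv_padicNorm_two_le (inv_nonneg.2 (padicNorm.nonneg _)) (padicNorm.nonneg _)).trans ?_
    rwa [mul_comm]

lemma padicNorm_powerSumS_div_sub_le {k : ℕ} (hk : Even k) (hk0 : 0 < k) (hm0 : 0 < m)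
    (hm : p ∣ m) (h5 : 5 ≤ p) :
    padicNorm p ((powerSumS k m : ℚ) / m - bernoulli k) ≤ padicNorm p m := by
  have hp0 : (0 : ℚ) < p := by exact_mod_cast hp.out.pos
  rw [powerSumS_div_sub_bernoulli hk0 hm0]
  refine padicNorm.sum_le' (fun i hi ↦ ?_) (padicNorm.nonneg _)
  have hik := mem_range.1 hi
  rcases Nat.even_or_odd i with he | ho
  · refine (padicNorm_bernoulli_even_term_le (d := 1) he hik hm fun v hv ↦ ?_).trans
      (le_of_eq (by field_simp))
    obtain ⟨a, ha⟩ := he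
    obtain ⟨b, hb⟩ := hk
    by_cases hj : k - i = 2
    · rw [hj] at hv ⊢
      have := lt_of_pow_dvd_succ (d := 1) h5 (by norm_num) (by norm_num) hv
      omega
    · have := lt_of_pow_dvd_succ h5 (add_one_lt_five_pow (by omega)) (by norm_num) hv
      omega
  · rcases padicNorm_bernoulli_odd_term hik ho m with h0 | ⟨rfl, h0⟩ <;> rw [h0]
    · simp [padicNorm.nonneg]
    rw [padicNorm.neg, padicNorm.div, padicNorm_two_of_five_le h5, div_one,
      IsAbsoluteValue.abv_pow (padicNorm p)]
    exact pow_le_of_le_one (padicNorm.nonneg _) (padicNorm.of_nat m) (by omega)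

lemma dvd_bernoulliNum_iff_lt_one {k : ℕ} (hD : ¬ p ∣ bernoulliDen k) :
    (p : ℤ) ∣ bernoulliNum k ↔ padicNorm p (bernoulli k) < 1 := by
  rw [← padicNorm_bernoulliNum_of_not_dvd hD, padicNorm.int_lt_one_iff]

/-- If `p` divides the numerator of `B_k` and `k ≡ 2` modulo `p - 1`, then `p ∣ k`. -/
lemma dvd_of_dvd_bernoulliNum {k : ℕ} (hk : Even k) (hk2 : 2 ≤ k)
    (hD : ¬ p ∣ bernoulliDen k) (hN : (p : ℤ) ∣ bernoulliNum k) (hd : p - 1 ∣ k - 2) :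
    p ∣ k := by
  have h5 := five_le_of_not_dvd_bernoulliDen hk (by omega) hD
  have hp0 : (p : ℚ) ≠ 0 := by exact_mod_cast hp.out.ne_zero
  obtain ⟨t, ht⟩ := hd
  obtain rfl : k = 2 + (p - 1) * t := by omega
  apply dvd_of_sq_dvd_sum_pow h5
  -- Taking `m = p`: `S_k(p)/p ≡ B_k ≡ 0` modulo `p`, so `p^2 ∣ S_k(p)`.
  have h1 := padicNorm_powerSumS_div_sub_le hk (by omega) hp.out.pos dvd_rfl h5
  rw [padicNorm.padicNorm_p_of_prime] at h1
  have h2 : padicNorm p (bernoulli (2 + (p - 1) * t)) ≤ (p : ℚ)⁻¹ := by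
    rw [← padicNorm_bernoulliNum_of_not_dvd hD]
    have := (padicNorm.dvd_iff_norm_le (p := p) (n := 1)).1 (by simpa using hN)
    simpa using this
  have h3 : padicNorm p ((powerSumS (2 + (p - 1) * t) p : ℚ) / p) ≤ (p : ℚ)⁻¹ := by
    rw [← sub_add_cancel ((powerSumS (2 + (p - 1) * t) p : ℚ) / p)
      (bernoulli (2 + (p - 1) * t))]
    exact padicNorm.nonarchimedean.trans (max_le h1 h2)
  rw [padicNorm.div, padicNorm.padicNorm_p_of_prime, div_inv_eq_mul] at h3
  have h4 : padicNorm p (powerSumS (2 + (p - 1) * t) p) ≤ (p : ℚ) ^ (-(2 : ℕ) : ℤ) := by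
    rw [zpow_neg, zpow_natCast, pow_two, mul_inv]
    rwa [← div_eq_mul_inv, le_div_iff₀ (by exact_mod_cast hp.out.pos)]
  rw [cast_powerSumS_eq_sum_range (by omega)] at h4
  rw [← Nat.cast_pow, padicNorm.dvd_iff_norm_le]
  exact_mod_cast h4

lemma three_le_of_dvd_bernoulliNum {k : ℕ} (hk : Even k) (hk0 : 0 < k)
    (hN : (p : ℤ) ∣ bernoulliNum k) : 3 ≤ k := by
  by_contra hlt
  obtain rfl : k = 2 := by obtain ⟨b, hb⟩ := hk; omega
  have : bernoulliNum 2 = 1 := by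
    rw [bernoulliNum, bernoulli_two]; norm_num
  rw [this] at hN
  exact (Nat.prime_iff_prime_int.1 hp.out).not_dvd_one hN

/-- At a prime dividing the numerator of `B_k`, the approximation of `B_k` by `S_k(m) / m` gains
a further factor of `p`. -/
lemma padicNorm_powerSumS_div_sub_le_div {k : ℕ} (hk : Even k) (hk0 : 0 < k) (hm0 : 0 < m)
    (hm : p ∣ m) (hD : ¬ p ∣ bernoulliDen k) (hN : (p : ℤ) ∣ bernoulliNum k) :
    padicNorm p ((powerSumS k m : ℚ) / m - bernoulli k) ≤ padicNorm p m / p := by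
  have hp0 : (0 : ℚ) < p := by exact_mod_cast hp.out.pos
  have h5 := five_le_of_not_dvd_bernoulliDen hk hk0 hD
  have hρ0 := padicNorm.nonneg (p := p) m
  have hρ := padicNorm_le_one_div_of_dvd hm
  have hρ1 := padicNorm.of_nat (p := p) m
  have hk3 := three_le_of_dvd_bernoulliNum hk hk0 hN
  have hsq : padicNorm p m ^ 2 ≤ padicNorm p m / p := by
    rw [pow_two, div_eq_mul_one_div]
    gcongr
  rw [powerSumS_div_sub_bernoulli hk0 hm0]
  refine padicNorm.sum_le' (fun i hi ↦ ?_) (by positivity)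
  have hik := mem_range.1 hi
  rcases Nat.even_or_odd i with he | ho
  · obtain ⟨b, hb⟩ := hk
    by_cases hj : k - i = 2
    · obtain ⟨n, rfl⟩ : ∃ n, k = n + 2 := ⟨k - 2, by omega⟩
      obtain rfl : i = n := by omega
      have h3 : padicNorm p ((((i + 2 - i : ℕ) : ℚ)) + 1) = 1 := by
        rw [hj]
        have := (padicNorm.nat_eq_one_iff (p := p) 3).2 fun h ↦ by
          have := Nat.le_of_dvd three_pos h
          omega
        rwa [show ((2 : ℕ) : ℚ) + 1 = (3 : ℕ) by norm_num]
      rw [hj] at h3 ⊢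
      rw [padicNorm.mul, padicNorm.div, h3, div_one, IsAbsoluteValue.abv_pow (padicNorm p)]
      refine (mul_le_of_le_one_left (by positivity) ?_).trans hsq
      rw [padicNorm.mul]
      -- If `p - 1 ∣ k - 2`, the factor `p` in `C(k,2)` cancels the one in the denominator of
      -- `B_{k-2}`; otherwise `B_{k-2}` is already `p`-integral.
      by_cases hd : p - 1 ∣ i
      · have hpk := dvd_of_dvd_bernoulliNum ⟨b, hb⟩ (by omega) hD hN (by simpa using hd)
        have hc : (p : ℤ) ∣ ((i + 2).choose i : ℤ) := by
          rw [Int.natCast_dvd_natCast, Nat.choose_symm_add]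
          have h2 : 2 * (i + 2).choose 2 = (i + 2) * (i + 1) := by
            have := Nat.triangle_succ (i + 1)
            rw [Nat.choose_two_right, Nat.mul_div_cancel']
            · rfl
            · simpa [mul_comm] using (Nat.even_mul_succ_self (i + 1)).two_dvd
          have : p ∣ 2 * (i + 2).choose 2 := h2 ▸ hpk.mul_right _
          refine (hp.out.dvd_mul.1 this).resolve_left fun h ↦ ?_
          have := Nat.le_of_dvd two_pos h
          omega
        have hc' : padicNorm p ((i + 2).choose i) ≤ 1 / p :=
          padicNorm_le_one_div_of_dvd (by exact_mod_cast hc)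
        calc _ ≤ (p : ℚ) * (1 / p) := mul_le_mul (padicNorm_bernoulli_even_le he) hc'
              (padicNorm.nonneg _) hp0.le
          _ = 1 := mul_one_div_cancel hp0.ne'
      · exact mul_le_one₀ ((padicNorm_bernoulli_even he (by omega)).2 hd)
          (padicNorm.nonneg _) (padicNorm.of_nat _)
    · refine (padicNorm_bernoulli_even_term_le (d := 2) he hik hm fun v hv ↦ ?_).trans
        (le_of_eq (by field_simp))
      obtain ⟨a, ha⟩ := he
      have := lt_of_pow_dvd_succ h5 (add_one_lt_five_pow (by omega)) (by norm_num) hv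
      omega
  · rcases padicNorm_bernoulli_odd_term hik ho m with h0 | ⟨rfl, h0⟩ <;> rw [h0]
    · rw [padicNorm.zero]; positivity
    rw [padicNorm.neg, padicNorm.div, padicNorm_two_of_five_le h5, div_one,
      IsAbsoluteValue.abv_pow (padicNorm p)]
    -- Needs `k - 1 ≥ 2`; the case `k = 2` is excluded since `N_2 = 1`.
    exact (pow_le_pow_of_le_one hρ0 hρ1 (by omega)).trans hsq

end Expansion

/-! ### The norm of `g_k(m)` at each prime. -/

section LocalRatio

variable {p : ℕ} [hp : Fact p.Prime]

lemma padicNorm_le_of_dvd {a b : ℤ} (h : a ∣ b) : padicNorm p b ≤ padicNorm p a := by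
  obtain ⟨c, rfl⟩ := h
  rw [Int.cast_mul, padicNorm.mul]
  exact mul_le_of_le_one_right (padicNorm.nonneg _) (padicNorm.of_int c)

lemma padicNorm_gcd (a b : ℕ) :
    padicNorm p (Nat.gcd a b) = max (padicNorm p a) (padicNorm p b) := by
  apply le_antisymm
  · have h : (Nat.gcd a b : ℚ) = a * (Nat.gcdA a b : ℤ) + b * (Nat.gcdB a b : ℤ) := by
      exact_mod_cast Nat.gcd_eq_gcd_ab a b
    rw [h]
    refine padicNorm.nonarchimedean.trans (max_le_max ?_ ?_) <;> rw [padicNorm.mul] <;>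
      exact mul_le_of_le_one_right (padicNorm.nonneg _) (padicNorm.of_int _)
  · refine max_le ?_ ?_
    · exact_mod_cast padicNorm_le_of_dvd (p := p) (Int.natCast_dvd_natCast.2 (Nat.gcd_dvd_left a b))
    · exact_mod_cast padicNorm_le_of_dvd (p := p)
        (Int.natCast_dvd_natCast.2 (Nat.gcd_dvd_right a b))

variable {k m : ℕ}

lemma gcdRatio_pos (hm0 : 0 < m) : 0 < gcdRatio k m := by
  have : 0 < Nat.gcd (powerSumS k m) (powerSumS k (m + 1)) := by
    rw [powerSumS_succ k hm0, Nat.gcd_self_add_right]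
    exact Nat.gcd_pos_of_pos_right _ (pow_pos hm0 k)
  unfold gcdRatio
  positivity

lemma padicNorm_gcdRatio (hk0 : 0 < k) (hm0 : 0 < m) :
    padicNorm p (gcdRatio k m) =
      max (padicNorm p ((powerSumS k m : ℚ) / m)) (padicNorm p m ^ (k - 1)) := by
  have hρ : 0 < padicNorm p m := lt_of_le_of_ne (padicNorm.nonneg _)
    (padicNorm.nonzero (by exact_mod_cast hm0.ne')).symm
  rw [gcdRatio, powerSumS_succ k hm0, Nat.gcd_self_add_right, padicNorm.div, padicNorm_gcd,
    padicNorm.div, ← max_div_div_right hρ.le]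
  congr 1
  obtain ⟨n, rfl⟩ : ∃ n, k = n + 1 := ⟨k - 1, by omega⟩
  rw [Nat.cast_pow, IsAbsoluteValue.abv_pow (padicNorm p), Nat.add_sub_cancel, pow_succ,
    mul_div_cancel_right₀ _ hρ.ne']

lemma padicNorm_gcdRatio_of_not_dvd (hk0 : 0 < k) (hm0 : 0 < m) (hm : ¬ p ∣ m) :
    padicNorm p (gcdRatio k m) = 1 := by
  have h1 := (padicNorm.nat_eq_one_iff (p := p) m).2 hm
  rw [padicNorm_gcdRatio hk0 hm0, padicNorm.div, h1, one_pow, div_one]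
  exact max_eq_right (padicNorm.of_nat _)

lemma padicNorm_gcdRatio_of_dvd_den (hk : Even k) (hk0 : 0 < k) (hm0 : 0 < m) (hm : p ∣ m)
    (hD : p ∣ bernoulliDen k) : padicNorm p (gcdRatio k m) = p := by
  have hp1 : (1 : ℚ) < p := by exact_mod_cast hp.out.one_lt
  have hB := (padicNorm_bernoulli_even hk hk0).1 ((dvd_bernoulliDen_iff hk hk0).1 hD)
  have hE := padicNorm_powerSumS_div_sub_le_one hk hk0 hm0 hm
  have hx : padicNorm p ((powerSumS k m : ℚ) / m) = p := by
    rw [← sub_add_cancel ((powerSumS k m : ℚ) / m) (bernoulli k),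
      padicNorm.add_eq_max_of_ne (by rw [hB]; exact (hE.trans_lt hp1).ne), hB]
    exact max_eq_right (hE.trans hp1.le)
  rw [padicNorm_gcdRatio hk0 hm0, hx]
  exact max_eq_left ((pow_le_one₀ (padicNorm.nonneg _) (padicNorm.of_nat m)).trans hp1.le)

lemma padicNorm_gcdRatio_of_not_dvd_num (hk : Even k) (hk0 : 0 < k) (hm0 : 0 < m)
    (hD : ¬ p ∣ bernoulliDen k) (hN : ¬ (p : ℤ) ∣ bernoulliNum k) :
    padicNorm p (gcdRatio k m) = 1 := by
  by_cases hm : p ∣ m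
  · have h5 := five_le_of_not_dvd_bernoulliDen hk hk0 hD
    have hB : padicNorm p (bernoulli k) = 1 := by
      rw [← padicNorm_bernoulliNum_of_not_dvd hD, padicNorm.int_eq_one_iff]
      exact hN
    have hE := (padicNorm_powerSumS_div_sub_le hk hk0 hm0 hm h5).trans_lt
      ((padicNorm.nat_lt_one_iff m).2 hm)
    have hx : padicNorm p ((powerSumS k m : ℚ) / m) = 1 := by
      rw [← sub_add_cancel ((powerSumS k m : ℚ) / m) (bernoulli k),
        padicNorm.add_eq_max_of_ne (by rw [hB]; exact hE.ne), hB]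
      exact max_eq_right hE.le
    rw [padicNorm_gcdRatio hk0 hm0, hx]
    exact max_eq_left (pow_le_one₀ (padicNorm.nonneg _) (padicNorm.of_nat m))
  · exact padicNorm_gcdRatio_of_not_dvd hk0 hm0 hm

lemma padicNorm_gcdRatio_lt_one (hk : Even k) (hk0 : 0 < k) (hm0 : 0 < m) (hm : p ∣ m)
    (hD : ¬ p ∣ bernoulliDen k) (hN : (p : ℤ) ∣ bernoulliNum k) :
    padicNorm p (gcdRatio k m) < 1 := by
  have h5 := five_le_of_not_dvd_bernoulliDen hk hk0 hD
  have hρ := (padicNorm.nat_lt_one_iff (p := p) m).2 hm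
  rw [padicNorm_gcdRatio hk0 hm0]
  refine max_lt ?_ (pow_lt_one₀ (padicNorm.nonneg _) hρ ?_)
  · rw [← sub_add_cancel ((powerSumS k m : ℚ) / m) (bernoulli k)]
    exact padicNorm.nonarchimedean.trans_lt (max_lt
      ((padicNorm_powerSumS_div_sub_le hk hk0 hm0 hm h5).trans_lt hρ)
      ((dvd_bernoulliNum_iff_lt_one hD).1 hN))
  · have := three_le_of_dvd_bernoulliNum hk hk0 hN
    omega

/-- If `p ∣ N_k` and `v_p(m) ≥ v_p(N_k)`, then `g_k(m)` and `N_k` have the same `p`-adic size. -/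
lemma padicNorm_gcdRatio_eq_padicNorm_num (hk : Even k) (hk0 : 0 < k) (hm0 : 0 < m)
    (hm : p ∣ m) (hD : ¬ p ∣ bernoulliDen k) (hN : (p : ℤ) ∣ bernoulliNum k)
    (hle : padicNorm p m ≤ padicNorm p (bernoulliNum k)) :
    padicNorm p (gcdRatio k m) = padicNorm p (bernoulliNum k) := by
  have hk3 := three_le_of_dvd_bernoulliNum hk hk0 hN
  have hp1 : (1 : ℚ) < p := by exact_mod_cast hp.out.one_lt
  have hρ : 0 < padicNorm p m := lt_of_le_of_ne (padicNorm.nonneg _)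
    (padicNorm.nonzero (by exact_mod_cast hm0.ne')).symm
  have hlt := (padicNorm_powerSumS_div_sub_le_div hk hk0 hm0 hm hD hN).trans_lt
    ((div_lt_self hρ hp1).trans_le hle)
  have hBN := padicNorm_bernoulliNum_of_not_dvd hD
  have hx : padicNorm p ((powerSumS k m : ℚ) / m) = padicNorm p (bernoulliNum k) := by
    rw [← sub_add_cancel ((powerSumS k m : ℚ) / m) (bernoulli k),
      padicNorm.add_eq_max_of_ne (by rw [← hBN]; exact hlt.ne), ← hBN]
    exact max_eq_right hlt.le
  rw [padicNorm_gcdRatio hk0 hm0, hx]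
  exact max_eq_left ((pow_le_of_le_one hρ.le (padicNorm.of_nat m) (by omega)).trans hle)

/-- A crude bound, used only for finiteness of the set of values. When `|m| ≥ |N_k|` the error may
swamp `B_k`, but the term `|m|^(k-1)` already gives the estimate. -/
lemma padicNorm_num_pow_le_gcdRatio (hk : Even k) (hk0 : 0 < k) (hm0 : 0 < m) :
    padicNorm p (bernoulliNum k) ^ k ≤ padicNorm p (gcdRatio k m) := by
  have hN0 := padicNorm.nonneg (p := p) (bernoulliNum k)
  have hN1 := padicNorm.of_int (p := p) (bernoulliNum k)
  by_cases hD : p ∣ bernoulliDen k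
  · have h1 : 1 ≤ padicNorm p (gcdRatio k m) := by
      by_cases hm : p ∣ m
      · rw [padicNorm_gcdRatio_of_dvd_den hk hk0 hm0 hm hD]
        exact_mod_cast hp.out.one_le
      · exact (padicNorm_gcdRatio_of_not_dvd hk0 hm0 hm).ge
    exact (pow_le_one₀ hN0 hN1).trans h1
  · by_cases hN : (p : ℤ) ∣ bernoulliNum k
    · by_cases hm : p ∣ m
      · rcases le_total (padicNorm p m) (padicNorm p (bernoulliNum k)) with h | h
        · rw [padicNorm_gcdRatio_eq_padicNorm_num hk hk0 hm0 hm hD hN h]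
          exact pow_le_of_le_one hN0 hN1 hk0.ne'
        · rw [padicNorm_gcdRatio hk0 hm0]
          refine le_max_of_le_right ?_
          calc _ ≤ padicNorm p m ^ k := pow_le_pow_left₀ hN0 h k
            _ ≤ _ := pow_le_pow_of_le_one (padicNorm.nonneg _) (padicNorm.of_nat m) (by omega)
      · rw [padicNorm_gcdRatio_of_not_dvd hk0 hm0 hm]
        exact pow_le_one₀ hN0 hN1
    · rw [padicNorm_gcdRatio_of_not_dvd_num hk hk0 hm0 hD hN]
      exact pow_le_one₀ hN0 hN1

lemma padicNorm_num_le_gcdRatio_of_squarefree (hk : Even k) (hk0 : 0 < k) (hm0 : 0 < m)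
    (hsq : Squarefree (bernoulliNum k)) :
    padicNorm p (bernoulliNum k) ≤ padicNorm p (gcdRatio k m) := by
  have hN1 := padicNorm.of_int (p := p) (bernoulliNum k)
  by_cases hm : p ∣ m
  · by_cases hD : p ∣ bernoulliDen k
    · rw [padicNorm_gcdRatio_of_dvd_den hk hk0 hm0 hm hD]
      exact hN1.trans (by exact_mod_cast hp.out.one_le)
    · by_cases hN : (p : ℤ) ∣ bernoulliNum k
      · refine (padicNorm_gcdRatio_eq_padicNorm_num hk hk0 hm0 hm hD hN ?_).ge
        -- Squarefreeness makes `|N_k|` exactly `1/p`, so `p ∣ m` alone gives `|m| ≤ |N_k|`.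
        refine (padicNorm_le_one_div_of_dvd hm).trans ?_
        obtain ⟨c, hc⟩ := hN
        have hcp : ¬ (p : ℤ) ∣ c := fun ⟨d, hd⟩ ↦
          (Nat.prime_iff_prime_int.1 hp.out).not_isUnit (hsq p ⟨d, by rw [hc, hd, mul_assoc]⟩)
        rw [hc, Int.cast_mul, padicNorm.mul, (padicNorm.int_eq_one_iff c).2 hcp, mul_one,
          Int.cast_natCast, padicNorm.padicNorm_p_of_prime, one_div]
      · rw [padicNorm_gcdRatio_of_not_dvd_num hk hk0 hm0 hD hN]
        exact hN1
  · rw [padicNorm_gcdRatio_of_not_dvd hk0 hm0 hm]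
    exact hN1

end LocalRatio

/-! ### From all primes to rational equalities, inequalities and finiteness. -/

section Global

lemma exists_int_eq_of_padicNorm_le_one {q : ℚ}
    (h : ∀ p : ℕ, p.Prime → padicNorm p q ≤ 1) : ∃ z : ℤ, q = z := by
  refine ⟨q.num, (Rat.coe_int_num_of_den_eq_one ?_).symm⟩
  by_contra hd
  obtain ⟨p, hp, hpd⟩ := Nat.exists_prime_and_dvd hd
  have : Fact p.Prime := ⟨hp⟩
  have hn : padicNorm p q.num = 1 := by
    rw [padicNorm.int_eq_one_iff]
    intro h'
    exact hp.one_lt.ne' (Nat.dvd_one.1 (q.reduced ▸ Nat.dvd_gcd (Int.natCast_dvd.1 h') hpd))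
  have hd0 : (0 : ℚ) < padicNorm p q.den := lt_of_le_of_ne (padicNorm.nonneg _)
    (padicNorm.nonzero (by exact_mod_cast q.den_ne_zero)).symm
  have hq := h p hp
  rw [← Rat.num_div_den q, padicNorm.div, hn, div_le_one hd0] at hq
  exact absurd ((padicNorm.nat_lt_one_iff q.den).2 hpd) (not_lt.2 hq)

/-- If `a, b > 0` and `a` divides `b` `p`-adically for all primes `p`, then `a ≤ b`. -/
lemma le_of_forall_padicNorm_le {a b : ℚ} (ha : 0 < a) (hb : 0 < b)
    (h : ∀ p : ℕ, p.Prime → padicNorm p b ≤ padicNorm p a) : a ≤ b := by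
  obtain ⟨z, hz⟩ := exists_int_eq_of_padicNorm_le_one (q := b / a) fun p hp ↦ by
    have : Fact p.Prime := ⟨hp⟩
    rw [padicNorm.div]
    exact div_le_one_of_le₀ (h p hp) (padicNorm.nonneg _)
  have hz0 : (0 : ℚ) < z := hz ▸ div_pos hb ha
  have hz1 : (1 : ℚ) ≤ z := by exact_mod_cast (by exact_mod_cast hz0 : 0 < z)
  rwa [← hz, one_le_div ha] at hz1

lemma eq_of_forall_padicNorm_eq {a b : ℚ} (ha : 0 < a) (hb : 0 < b)
    (h : ∀ p : ℕ, p.Prime → padicNorm p a = padicNorm p b) : a = b :=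
  le_antisymm (le_of_forall_padicNorm_le ha hb fun p hp ↦ (h p hp).ge)
    (le_of_forall_padicNorm_le hb ha fun p hp ↦ (h p hp).le)

variable {k m : ℕ}

lemma bernoulliDen_pos (k : ℕ) : 0 < bernoulliDen k := (bernoulli k).den_pos

lemma two_dvd_bernoulliDen (hk : Even k) (hk0 : 0 < k) : 2 ∣ bernoulliDen k :=
  have : Fact (Nat.Prime 2) := ⟨Nat.prime_two⟩
  (dvd_bernoulliDen_iff hk hk0).2 (by simp)

lemma bernoulliNum_ne_zero (hk : Even k) (hk0 : 0 < k) : bernoulliNum k ≠ 0 := by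
  intro h
  have h2 := two_dvd_bernoulliDen hk hk0
  have h0 : bernoulli k = 0 := Rat.num_eq_zero.1 h
  rw [bernoulliDen, h0] at h2
  norm_num at h2

lemma padicNorm_abs (p : ℕ) (q : ℚ) : padicNorm p |q| = padicNorm p q := by
  rcases abs_choice q with h | h <;> rw [h]
  exact padicNorm.neg q

lemma padicNorm_one_div_bernoulliDen (hk : Even k) (hk0 : 0 < k) {p : ℕ} [hp : Fact p.Prime] :
    padicNorm p (1 / bernoulliDen k) = if p ∣ bernoulliDen k then (p : ℚ) else 1 := by
  rw [padicNorm.div, padicNorm.one]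
  split_ifs with h
  · rw [padicNorm_bernoulliDen_of_dvd hk hk0 h, one_div_one_div]
  · rw [(padicNorm.nat_eq_one_iff _).2 h, one_div_one]

lemma padicNorm_gcdRatio_le (hk : Even k) (hk0 : 0 < k) (hm0 : 0 < m) {p : ℕ}
    [hp : Fact p.Prime] :
    padicNorm p (gcdRatio k m) ≤ if p ∣ bernoulliDen k then (p : ℚ) else 1 := by
  have hp1 : (1 : ℚ) ≤ p := by exact_mod_cast hp.out.one_le
  by_cases hm : p ∣ m
  · split_ifs with hD
    · exact (padicNorm_gcdRatio_of_dvd_den hk hk0 hm0 hm hD).le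
    · by_cases hN : (p : ℤ) ∣ bernoulliNum k
      · exact (padicNorm_gcdRatio_lt_one hk hk0 hm0 hm hD hN).le
      · exact (padicNorm_gcdRatio_of_not_dvd_num hk hk0 hm0 hD hN).le
  · rw [padicNorm_gcdRatio_of_not_dvd hk0 hm0 hm]
    split_ifs <;> simp [hp1]

lemma one_div_bernoulliDen_le_gcdRatio (hk : Even k) (hk0 : 0 < k) (hm0 : 0 < m) :
    1 / (bernoulliDen k : ℚ) ≤ gcdRatio k m := by
  refine le_of_forall_padicNorm_le (one_div_pos.2 (by exact_mod_cast bernoulliDen_pos k))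
    (gcdRatio_pos hm0) fun p hp ↦ ?_
  have : Fact p.Prime := ⟨hp⟩
  rw [padicNorm_one_div_bernoulliDen hk hk0]
  exact padicNorm_gcdRatio_le hk hk0 hm0

lemma gcdRatio_bernoulliDen (hk : Even k) (hk0 : 0 < k) :
    gcdRatio k (bernoulliDen k) = 1 / (bernoulliDen k : ℚ) := by
  have hD0 := bernoulliDen_pos k
  refine eq_of_forall_padicNorm_eq (gcdRatio_pos hD0)
    (one_div_pos.2 (by exact_mod_cast hD0)) fun p hp ↦ ?_
  have : Fact p.Prime := ⟨hp⟩
  rw [padicNorm_one_div_bernoulliDen hk hk0]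
  split_ifs with h
  · exact padicNorm_gcdRatio_of_dvd_den hk hk0 hD0 h h
  · exact padicNorm_gcdRatio_of_not_dvd hk0 hD0 h

lemma gcdRatio_natAbs_bernoulliNum (hk : Even k) (hk0 : 0 < k) :
    gcdRatio k (bernoulliNum k).natAbs = |(bernoulliNum k : ℚ)| := by
  have hN0 := bernoulliNum_ne_zero hk hk0
  have hn0 : 0 < (bernoulliNum k).natAbs := Int.natAbs_pos.2 hN0
  refine eq_of_forall_padicNorm_eq (gcdRatio_pos hn0)
    (abs_pos.2 (by exact_mod_cast hN0)) fun p hp ↦ ?_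
  have : Fact p.Prime := ⟨hp⟩
  rw [padicNorm_abs]
  by_cases hN : (p : ℤ) ∣ bernoulliNum k
  · have hD : ¬ p ∣ bernoulliDen k := fun h ↦ (padicNorm.int_eq_one_iff _).1
      (padicNorm_bernoulliNum_of_dvd h) hN
    refine padicNorm_gcdRatio_eq_padicNorm_num hk hk0 hn0 (Int.natCast_dvd.1 hN) hD hN ?_
    rw [Nat.cast_natAbs, Int.cast_abs, padicNorm_abs]
  · rw [(padicNorm.int_eq_one_iff _).2 hN]
    exact padicNorm_gcdRatio_of_not_dvd hk0 hn0 fun h ↦ hN (Int.natCast_dvd.2 h)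

lemma gcdRatio_eq_one_iff (hk : Even k) (hk0 : 0 < k) (hm0 : 0 < m) :
    gcdRatio k m = 1 ↔ Int.gcd ((bernoulliDen k : ℤ) * bernoulliNum k) (m : ℤ) = 1 := by
  constructor
  · intro h
    by_contra hg
    obtain ⟨p, hp, hpg⟩ := Nat.exists_prime_and_dvd hg
    have : Fact p.Prime := ⟨hp⟩
    have hpg' := Int.natCast_dvd_natCast.2 hpg
    have hm : p ∣ m := Int.natCast_dvd_natCast.1 (hpg'.trans (Int.gcd_dvd_right ..))
    have h1 : padicNorm p (gcdRatio k m) = 1 := by rw [h, padicNorm.one]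
    by_cases hD : p ∣ bernoulliDen k
    · rw [padicNorm_gcdRatio_of_dvd_den hk hk0 hm0 hm hD] at h1
      exact hp.one_lt.ne' (by exact_mod_cast h1)
    · have hN := ((Nat.prime_iff_prime_int.1 hp).dvd_or_dvd
        (hpg'.trans (Int.gcd_dvd_left ..))).resolve_left
          fun h ↦ hD (Int.natCast_dvd_natCast.1 h)
      exact (padicNorm_gcdRatio_lt_one hk hk0 hm0 hm hD hN).ne h1
  · intro h
    refine eq_of_forall_padicNorm_eq (gcdRatio_pos hm0) one_pos fun p hp ↦ ?_
    have : Fact p.Prime := ⟨hp⟩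
    rw [padicNorm.one]
    by_cases hm : p ∣ m
    · have hnd : ¬ (p : ℤ) ∣ (bernoulliDen k : ℤ) * bernoulliNum k := fun hd ↦ by
        have := Int.dvd_coe_gcd hd (Int.natCast_dvd_natCast.2 hm)
        rw [h] at this
        exact (Nat.prime_iff_prime_int.1 hp).not_dvd_one (by exact_mod_cast this)
      exact padicNorm_gcdRatio_of_not_dvd_num hk hk0 hm0
        (fun hd ↦ hnd ((Int.natCast_dvd_natCast.2 hd).mul_right _)) fun hd ↦ hnd (hd.mul_left _)
    · exact padicNorm_gcdRatio_of_not_dvd hk0 hm0 hm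

lemma gcdRatio_le_abs_bernoulliNum_pow (hk : Even k) (hk0 : 0 < k) (hm0 : 0 < m) :
    gcdRatio k m ≤ |(bernoulliNum k : ℚ)| ^ k := by
  have hN : (0 : ℚ) < |(bernoulliNum k : ℚ)| :=
    abs_pos.2 (by exact_mod_cast bernoulliNum_ne_zero hk hk0)
  refine le_of_forall_padicNorm_le (gcdRatio_pos hm0) (pow_pos hN k) fun p hp ↦ ?_
  have : Fact p.Prime := ⟨hp⟩
  rw [IsAbsoluteValue.abv_pow (padicNorm p), padicNorm_abs]
  exact padicNorm_num_pow_le_gcdRatio hk hk0 hm0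

lemma gcdRatio_le_abs_bernoulliNum_of_squarefree (hk : Even k) (hk0 : 0 < k) (hm0 : 0 < m)
    (hsq : Squarefree (bernoulliNum k)) : gcdRatio k m ≤ |(bernoulliNum k : ℚ)| := by
  have hN : (0 : ℚ) < |(bernoulliNum k : ℚ)| :=
    abs_pos.2 (by exact_mod_cast bernoulliNum_ne_zero hk hk0)
  refine le_of_forall_padicNorm_le (gcdRatio_pos hm0) hN fun p hp ↦ ?_
  have : Fact p.Prime := ⟨hp⟩
  rw [padicNorm_abs]
  exact padicNorm_num_le_gcdRatio_of_squarefree hk hk0 hm0 hsq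

lemma abs_bernoulliNum_mem_image_gcdRatio (hk : Even k) (hk0 : 0 < k) :
    |(bernoulliNum k : ℚ)| ∈ gcdRatio k '' {m : ℕ | 2 ≤ m} := by
  have hN0 := Int.natAbs_pos.2 (bernoulliNum_ne_zero hk hk0)
  -- If `|N_k| = 1`, the point `m = |N_k|` violates `m ≥ 2`; a prime larger than `D_k` is coprime to
  -- `D_k N_k` and also gives the value 1.
  rcases (Nat.succ_le_of_lt hN0).eq_or_lt with h1 | h2
  · obtain ⟨q, hq, hqp⟩ := Nat.exists_infinite_primes (bernoulliDen k + 1)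
    refine ⟨q, hqp.two_le, ?_⟩
    have hN : |(bernoulliNum k : ℚ)| = 1 := by
      rw [← Int.cast_abs, ← Int.natCast_natAbs, ← h1]; norm_num
    rw [hN, gcdRatio_eq_one_iff hk hk0 hqp.pos, Int.gcd_eq_natAbs, Int.natAbs_mul, ← h1]
    simp only [Int.natAbs_natCast]
    rw [Nat.succ_eq_add_one, zero_add, mul_one, ← Nat.coprime_iff_gcd_eq_one, Nat.coprime_comm, hqp.coprime_iff_not_dvd]
    intro hd
    have := Nat.le_of_dvd (bernoulliDen_pos k) hd
    omega
  · exact ⟨_, h2, gcdRatio_natAbs_bernoulliNum hk hk0⟩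

/-- `D_k * g_k(m)` is `p`-integral for every `p`, hence a positive integer, and it is at most `D_k *
|N_k|^k`. -/
lemma finite_image_gcdRatio (hk : Even k) (hk0 : 0 < k) :
    (gcdRatio k '' {m : ℕ | 2 ≤ m}).Finite := by
  have hD0 : (0 : ℚ) < bernoulliDen k := by exact_mod_cast bernoulliDen_pos k
  refine ((Set.finite_Icc (0 : ℤ) (bernoulliDen k * |bernoulliNum k| ^ k)).image
    fun z : ℤ ↦ (z : ℚ) / bernoulliDen k).subset ?_
  rintro _ ⟨m, hm, rfl⟩
  have hm0 : 0 < m := lt_of_lt_of_le two_pos hm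
  obtain ⟨z, hz⟩ := exists_int_eq_of_padicNorm_le_one
    (q := gcdRatio k m / (1 / bernoulliDen k)) fun p hp ↦ by
      have : Fact p.Prime := ⟨hp⟩
      rw [padicNorm.div, padicNorm_one_div_bernoulliDen hk hk0]
      exact div_le_one_of_le₀ (padicNorm_gcdRatio_le hk hk0 hm0)
        (by split_ifs <;> positivity)
  rw [div_div_eq_mul_div, div_one] at hz
  refine ⟨z, ⟨?_, ?_⟩, ?_⟩
  · have : (0 : ℚ) ≤ z := hz ▸ (mul_pos (gcdRatio_pos hm0) hD0).le
    exact_mod_cast this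
  · have : (z : ℚ) ≤ bernoulliDen k * |(bernoulliNum k : ℚ)| ^ k := by
      rw [← hz, mul_comm]
      exact mul_le_mul_of_nonneg_left (gcdRatio_le_abs_bernoulliNum_pow hk hk0 hm0) hD0.le
    exact_mod_cast this
  · simp only [← hz]
    field_simp

end Global

theorem mainTheorem1 (k : ℕ) (hk : 0 < k) (hk_even : Even k) :
    IsLeast (gcdRatio k '' {m : ℕ | 2 ≤ m}) (1 / (bernoulliDen k : ℚ)) ∧
    (∃ M : ℚ, IsGreatest (gcdRatio k '' {m : ℕ | 2 ≤ m}) M ∧ |(bernoulliNum k : ℚ)| ≤ M) ∧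
    (∀ m : ℕ, 0 < m →
      (gcdRatio k m = 1 ↔ Int.gcd ((bernoulliDen k : ℤ) * bernoulliNum k) (m : ℤ) = 1)) ∧
    gcdRatio k (bernoulliDen k) = 1 / (bernoulliDen k : ℚ) ∧
    gcdRatio k (bernoulliNum k).natAbs = |(bernoulliNum k : ℚ)| ∧
    (Squarefree (bernoulliNum k) →
      IsGreatest (gcdRatio k '' {m : ℕ | 2 ≤ m}) |(bernoulliNum k : ℚ)|) := by
  have hmem := abs_bernoulliNum_mem_image_gcdRatio hk_even hk
  refine ⟨⟨⟨bernoulliDen k, ?_, gcdRatio_bernoulliDen hk_even hk⟩, ?_⟩, ?_,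
    fun m hm ↦ gcdRatio_eq_one_iff hk_even hk hm, gcdRatio_bernoulliDen hk_even hk,
    gcdRatio_natAbs_bernoulliNum hk_even hk, fun hsq ↦ ⟨hmem, ?_⟩⟩
  · exact Nat.le_of_dvd (bernoulliDen_pos k) (two_dvd_bernoulliDen hk_even hk)
  · rintro _ ⟨m, hm, rfl⟩
    exact one_div_bernoulliDen_le_gcdRatio hk_even hk (lt_of_lt_of_le two_pos hm)
  · obtain ⟨M, hM, hmax⟩ :=
      Set.exists_max_image _ id (finite_image_gcdRatio hk_even hk) ⟨_, hmem⟩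
    exact ⟨M, ⟨hM, hmax⟩, hmax _ hmem⟩
  · rintro _ ⟨m, hm, rfl⟩
    exact gcdRatio_le_abs_bernoulliNum_of_squarefree hk_even hk
      (lt_of_lt_of_le two_pos hm) hsq
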